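/- Let $k$ and $r$ be integers with $0\le r\le k-3$. Every finite simple graph on $n$ vertices with more than $\frac{(k-1)n}{2}$ edges contains, as a (not necessarily induced) subgraph, a keyring with exactly $r$ leaves and at least $k$ edges. Here a keyring with $r$ leaves is a graph obtained from a cycle (of length at least $3$) by adding $r$ new vertices, each joined by a single edge to one and the same vertex of the cycle. -/

import Mathlib

/-- The keyring obtained from the cycle on `c` vertices (meant for `3 ≤ c`) by appending
`r` leaves to one of its vertices: the cycle lives on the left summand, and each vertex of the
right summand is joined to vertex `0` of the cycle and to nothing else. -/
def keyringGraph (c r : ℕ) : SimpleGraph (Fin c ⊕ Fin r) where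
  Adj x y :=
    match x, y with
    | Sum.inl i, Sum.inl j => (SimpleGraph.cycleGraph c).Adj i j
    | Sum.inl i, Sum.inr _ => i.val = 0
    | Sum.inr _, Sum.inl i => i.val = 0
    | Sum.inr _, Sum.inr _ => False
  symm := ⟨by
    rintro (i | i) (j | j) h
    · exact SimpleGraph.Adj.symm h
    · exact h
    · exact h
    · exact h⟩
  loopless := ⟨by
    rintro (i | i) h
    · exact SimpleGraph.Adj.ne h rfl
    · exact h⟩

/-- `H` is a keyring with `r` leaves: up to isomorphism, it is obtained from a cycle (of some
length `c ≥ 3`) by appending `r` leaves to one of its vertices. -/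
def IsKeyring {W : Type*} (H : SimpleGraph W) (r : ℕ) : Prop :=
  ∃ c : ℕ, 3 ≤ c ∧ Nonempty (H ≃g keyringGraph c r)

/-! A vertex set that is minimal among nonempty sets `S` with degree sum inside `S` above `(k -
1)(|S| - 1)` induces a graph without cut vertices, of minimum degree at least `k / 2`, having a
vertex `v` of degree at least `k - 1`. By `exists_cycle_list_of_two_connected`, `v` lies on a cycle
of length at least `k`. Among the cycles through `v` of length at least `k - r`, one that no chord
at `v` can shorten contains at most `k - r - 1` neighbours of `v`; `r` others remain as leaves, and
the keyring has at least `(k - r) + r` edges.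

The core is the cycle through `v`. If a longest one is shorter than `k`, then `v` has a neighbour in
a component `H` of the rest. Every path through `H` between two cycle vertices bounds from below the
arc it could replace. `exists_long_path_to` makes one such path long, and adding up the bounds
around the cycle gives length at least `2 * d`. -/

/-! ### Paths as vertex lists. -/

/-- The list `l` runs through the vertices of a path of `G` from `x` to `y` inside `S`. -/
structure IsPathList {V : Type*} (G : SimpleGraph V) (S : Set V) (x y : V) (l : List V) :
    Prop where
  chain : l.IsChain G.Adj
  nodup : l.Nodup
  head : l.head? = some x
  last : l.getLast? = some y
  sub : ∀ z ∈ l, z ∈ S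

namespace IsPathList

variable {V : Type*} {G : SimpleGraph V} {S T : Set V} {x y z u : V} {l l' : List V}

theorem mono (h : IsPathList G S x y l) (hST : S ⊆ T) : IsPathList G T x y l :=
  ⟨h.chain, h.nodup, h.head, h.last, fun z hz => hST (h.sub z hz)⟩

theorem single (hx : x ∈ S) : IsPathList G S x x [x] :=
  ⟨by simp, by simp, by simp, by simp, by simpa⟩

theorem mem_last (h : IsPathList G S x y l) : y ∈ l := List.mem_of_getLast? h.last

theorem mem_head (h : IsPathList G S x y l) : x ∈ l := List.mem_of_head? h.head

theorem ne_nil (h : IsPathList G S x y l) : l ≠ [] := List.ne_nil_of_mem h.mem_head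

theorem length_pos (h : IsPathList G S x y l) : 0 < l.length :=
  List.length_pos_of_mem h.mem_head

theorem reverse (h : IsPathList G S x y l) : IsPathList G S y x l.reverse := by
  refine ⟨?_, by simpa using h.nodup, by simpa using h.last, by simpa using h.head, ?_⟩
  · rw [List.isChain_reverse]
    exact h.chain.imp fun _ _ hab => hab.symm
  · simpa using h.sub

theorem append (h : IsPathList G S x y l) (h' : IsPathList G T z u l') (hyz : G.Adj y z)
    (hd : ∀ a ∈ l, a ∉ l') : IsPathList G (S ∪ T) x u (l ++ l') := by
  refine ⟨?_, ?_, ?_, ?_, ?_⟩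
  · refine h.chain.append h'.chain ?_
    intro a ha b hb
    rw [h.last] at ha
    rw [h'.head] at hb
    cases ha; cases hb
    exact hyz
  · refine List.nodup_append.2 ⟨h.nodup, h'.nodup, ?_⟩
    rintro a ha b hb rfl
    exact hd a ha hb
  · simp [h.head]
  · simp [h'.last]
  · intro w hw
    rcases List.mem_append.1 hw with hw | hw
    · exact Or.inl (h.sub w hw)
    · exact Or.inr (h'.sub w hw)

theorem take (h : IsPathList G S x y l) {i : ℕ} (hi : i < l.length) :
    IsPathList G S x l[i] (l.take (i + 1)) := by
  refine ⟨h.chain.take _, h.nodup.sublist (List.take_sublist _ _), ?_, ?_, ?_⟩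
  · simp [List.head?_take, h.head]
  · simp [List.getLast?_take, hi]
  · exact fun z hz => h.sub z (List.mem_of_mem_take hz)

theorem drop (h : IsPathList G S x y l) {i : ℕ} (hi : i < l.length) :
    IsPathList G S l[i] y (l.drop i) := by
  refine ⟨h.chain.drop _, h.nodup.sublist (List.drop_sublist _ _), ?_, ?_, ?_⟩
  · simp [List.head?_drop, hi]
  · rw [List.getLast?_drop, if_neg (by omega), h.last]
  · exact fun z hz => h.sub z (List.mem_of_mem_drop hz)

theorem getElem_zero (h : IsPathList G S x y l) (h0 : 0 < l.length) : l[0] = x := by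
  have := h.head
  rw [List.head?_eq_getElem?, List.getElem?_eq_getElem h0] at this
  exact Option.some.inj this

/-- If no subset of `T` containing `b` and closed under adjacency in `T` avoids `M`, then `b` is
joined to `M` by a path inside `T`. -/
theorem exists_of_closed {M : Set V} {b : V} (hb : b ∈ T)
    (h : ∀ A ⊆ T, b ∈ A → (∀ a ∈ A, ∀ c ∈ T, G.Adj a c → c ∈ A) → ∃ a ∈ A, a ∈ M) :
    ∃ z ∈ M, ∃ l, IsPathList G T b z l := by
  obtain ⟨a, ⟨l, hl⟩, haM⟩ := h {z | ∃ l, IsPathList G T b z l}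
    (fun z ⟨l, hl⟩ => hl.sub z hl.mem_last) ⟨[b], single hb⟩ (by
      rintro a ⟨l, hl⟩ c hc hac
      by_cases hcl : c ∈ l
      · obtain ⟨i, hi, rfl⟩ := List.getElem_of_mem hcl
        exact ⟨_, hl.take hi⟩
      · refine ⟨l ++ [c], ?_⟩
        have := hl.append (single (G := G) hc) hac (by rintro a ha hac; simp at hac; grind)
        simpa using this)
  exact ⟨a, haM, l, hl⟩

end IsPathList

/-! ### Long paths under a minimum degree condition. -/

section LongPath

variable {V : Type*} {G : SimpleGraph V}

/-- Given a path from `y` to `z` in a connected set `H` and a vertex `w` of `H`, there are paths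
in `H` from `w` to `y` and to `z` whose lengths add up to at least that of the given one. -/
theorem IsPathList.tripod {H : Set V}
    (hconn : ∀ A ⊆ H, A.Nonempty → A ≠ H → ∃ a ∈ A, ∃ b ∈ H, b ∉ A ∧ G.Adj a b)
    {y z w : V} {l : List V} (hl : IsPathList G H y z l) (hw : w ∈ H) :
    ∃ i < l.length, ∃ l₁ l₂, IsPathList G H w y l₁ ∧ IsPathList G H w z l₂ ∧
      i + 1 ≤ l₁.length ∧ l.length ≤ l₂.length + i := by
  by_cases hwl : w ∈ l
  · obtain ⟨i, hi, rfl⟩ := List.getElem_of_mem hwl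
    exact ⟨i, hi, _, _, (hl.take hi).reverse, hl.drop hi, by simp; omega, by simp; omega⟩
  -- A path from `w` that meets `l` only through its last edge, towards `l[i]`, can follow `l` in
  -- either direction from there.
  · obtain ⟨a, ⟨i, hi, ha⟩, p, hp⟩ := IsPathList.exists_of_closed (G := G) (b := w)
      (T := {x | x ∈ H ∧ x ∉ l}) (M := {a | ∃ i, ∃ hi : i < l.length, G.Adj a l[i]})
      ⟨hw, hwl⟩ (by
        intro A hA hwA hcl
        obtain ⟨a, ha, b, hbH, hbA, hab⟩ := hconn A (fun x hx => (hA hx).1) ⟨w, hwA⟩ (by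
          rintro rfl
          exact (hA (hl.sub y hl.mem_head)).2 hl.mem_head)
        have hbl : b ∈ l := by
          by_contra hbl
          exact hbA (hcl a ha b ⟨hbH, hbl⟩ hab)
        obtain ⟨i, hi, rfl⟩ := List.getElem_of_mem hbl
        exact ⟨a, ha, i, hi, hab⟩)
    have hsub : {x | x ∈ H ∧ x ∉ l} ∪ H ⊆ H := by
      rintro x (hx | hx)
      exacts [hx.1, hx]
    have hpos := hp.length_pos
    refine ⟨i, hi, p ++ (l.take (i + 1)).reverse, p ++ l.drop i,
      (hp.append (hl.take hi).reverse ha ?_).mono hsub, (hp.append (hl.drop hi) ha ?_).mono hsub,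
      by simp; omega, by simp; omega⟩
    · intro x hx hx'
      exact (hp.sub x hx).2 (List.mem_of_mem_take (List.mem_reverse.1 hx'))
    · intro x hx hx'
      exact (hp.sub x hx).2 (List.mem_of_mem_drop hx')

open Classical in
/-- If contracting `W` makes `S ∪ W` two-connected after adding the edge from `u` to the
contracted vertex, and the other vertices of `S` have degree at least `d` after the contraction,
then there is a path with at least `d` vertices in `S` from `u` to a neighbour of `W`. -/
theorem exists_long_path_to (d : ℕ) (S : Finset V) (u : V) (W : Set V) (hu : u ∈ S)
    (hWS : ∀ x ∈ W, x ∉ S)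
    (hconn : ∀ A ⊆ S, u ∉ A → A.Nonempty → ∃ a ∈ A, ∃ b ∈ S, b ∉ A ∧ G.Adj a b)
    (hcut : ∀ A ⊆ S, u ∉ A → A.Nonempty → ∀ x ∈ S, x ∉ A →
      ∃ a ∈ A, ∃ b, (b ∈ S ∨ b ∈ W) ∧ b ∉ A ∧ b ≠ x ∧ G.Adj a b)
    (hdeg : ∀ z ∈ S, z ≠ u →
      d ≤ (S.filter (G.Adj z)).card + if ∃ w ∈ W, G.Adj z w then 1 else 0)
    (hbase : S = {u} → d ≤ 1 ∧ ∃ w ∈ W, G.Adj u w) :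
    ∃ z, (∃ w ∈ W, G.Adj z w) ∧ ∃ l, IsPathList G S u z l ∧ d ≤ l.length := by
  -- A minimal candidate `K`, entered from `u` at `u'`, inherits all hypotheses with `u'`, `B` and
  -- `d - 1` for `u`, `W` and `d`; minimality supplies the connectivity.
  induction hn : S.card using Nat.strong_induction_on generalizing d S u W with
  | _ n ih =>
  by_cases hS : S = {u}
  · obtain ⟨hd, hw⟩ := hbase hS
    exact ⟨u, hw, [u], IsPathList.single (by simpa using hu), by simpa using hd⟩
  have hne : (S.erase u).Nonempty := by
    by_contra hcon
    rw [Finset.not_nonempty_iff_eq_empty, Finset.erase_eq_empty_iff] at hcon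
    rcases hcon with rfl | hcon
    · simp at hu
    · exact hS hcon
  -- Candidates: sets with a neighbour of `u` all of whose exits, but `u`, lie in `B`, where `B`
  -- is either `W` or a single vertex of `S`.
  let good : Finset V → Set V → Prop := fun K B =>
    K ⊆ S ∧ u ∉ K ∧ (∃ a ∈ K, G.Adj u a) ∧ (∀ x ∈ B, x ∉ K ∧ x ≠ u) ∧
      (B = W ∨ ∃ b ∈ S, B = {b}) ∧
      ∀ a ∈ K, ∀ c, (c ∈ S ∨ c ∈ W) → G.Adj a c → c ∈ K ∨ c = u ∨ c ∈ B
  have hex : ∃ K, ∃ B, good K B := by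
    refine ⟨S.erase u, W, Finset.erase_subset _ _, by simp, ?_, ?_, Or.inl rfl, ?_⟩
    · obtain ⟨a, ha, b, hbS, hbA, hab⟩ := hconn _ (Finset.erase_subset u S) (by simp) hne
      have : b = u := by simpa [hbS] using hbA
      subst this
      exact ⟨a, ha, hab.symm⟩
    · intro x hx
      have := hWS x hx
      exact ⟨fun h => this (Finset.mem_of_mem_erase h), fun h => this (h ▸ hu)⟩
    · intro a _ c hc _
      by_cases hcu : c = u
      · simp [hcu]
      · rcases hc with hc | hc
        · simp [hcu, hc]
        · simp [hc]
  obtain ⟨K, ⟨B, hKB⟩, hmin⟩ : ∃ K, (∃ B, good K B) ∧ ∀ K', (∃ B, good K' B) →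
      K.card ≤ K'.card := by
    obtain ⟨K, hK, hm⟩ := WellFounded.has_min (measure (Finset.card : Finset V → ℕ)).wf
      {K | ∃ B, good K B} hex
    exact ⟨K, hK, fun K' hK' => not_lt.1 (hm K' hK')⟩
  obtain ⟨hKS, huK, ⟨u', hu'K, huu'⟩, hBK, hB, hexit⟩ := hKB
  have hu'u : u' ≠ u := fun h => huK (h ▸ hu'K)
  -- A subset of `K` missing `u'` has two exits other than `u`.
  have key : ∀ A ⊆ K, u' ∉ A → A.Nonempty → ∀ x ∈ S, x ∉ A →
      ∃ a ∈ A, ∃ b, (b ∈ K ∨ b ∈ B) ∧ b ∉ A ∧ b ≠ x ∧ G.Adj a b := by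
    intro A hAK hu'A hAne x hxS hxA
    by_contra! hcon
    have huA : u ∉ A := fun h => huK (hAK h)
    have hAS := hAK.trans hKS
    have hlt : A.card < K.card := Finset.card_lt_card ⟨hAK, fun h => hu'A (h hu'K)⟩
    have hout : ∀ a ∈ A, ∀ c, (c ∈ S ∨ c ∈ W) → G.Adj a c → c ∈ A ∨ c = u ∨ c = x := by
      intro a ha c hc hac
      by_contra! hcc
      rcases hexit a (hAK ha) c hc hac with h | h | h
      · exact hcon a ha c (Or.inl h) hcc.1 hcc.2.2 hac
      · exact hcc.2.1 h
      · exact hcon a ha c (Or.inr h) hcc.1 hcc.2.2 hac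
    obtain ⟨a, ha, b, hbSW, hbA, hbx, hab⟩ := hcut A hAS huA hAne x hxS hxA
    have hbu : b = u := by
      rcases hout a ha b hbSW hab with h | h | h
      exacts [absurd h hbA, h, absurd h hbx]
    by_cases hxu : x = u
    · exact hbx (hbu.trans hxu.symm)
    -- All exits of `A` are `u` or `x`, and `u` is one of them, so `A` with `{x}` would be a smaller
    -- candidate.
    have := hmin A ⟨{x}, hAS, huA, ⟨a, ha, hbu ▸ hab.symm⟩, by simp [hxA, hxu],
      Or.inr ⟨x, hxS, rfl⟩, by simpa using hout⟩
    omega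
  have hKconn : ∀ A ⊆ K, u' ∉ A → A.Nonempty → ∃ a ∈ A, ∃ b ∈ K, b ∉ A ∧ G.Adj a b := by
    intro A hAK hu'A hAne
    by_contra! hcon
    rcases hB with rfl | ⟨b, hb, rfl⟩
    · have huA : u ∉ A := fun h => huK (hAK h)
      obtain ⟨a, ha, c, hcS, hcA, hac⟩ := hconn A (hAK.trans hKS) huA hAne
      have hlt : A.card < K.card := Finset.card_lt_card ⟨hAK, fun h => hu'A (h hu'K)⟩
      have hcu : c = u := by
        rcases hexit a (hAK ha) c (Or.inl hcS) hac with h | h | h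
        · exact absurd hac (hcon a ha c h hcA)
        · exact h
        · exact absurd hcS (hWS c h)
      have := hmin A ⟨B, hAK.trans hKS, huA, ⟨a, ha, hcu ▸ hac.symm⟩,
        fun x hx => ⟨fun h => (hBK x hx).1 (hAK h), (hBK x hx).2⟩, Or.inl rfl, by
          intro a ha c hc hac
          rcases hexit a (hAK ha) c hc hac with h | h | h
          · left
            by_contra hcA
            exact hcon a ha c h hcA hac
          · exact Or.inr (Or.inl h)
          · exact Or.inr (Or.inr h)⟩
      omega
    · obtain ⟨a, ha, c, hc, hcA, hcb, hac⟩ := key A hAK hu'A hAne b hb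
        (fun h => (hBK b rfl).1 (hAK h))
      rcases hc with hc | hc
      · exact hcon a ha c hc hcA hac
      · exact hcb hc
  -- Only the neighbour `u` is really lost: if `B` is a single vertex of `S`, it leaves `S` but is
  -- counted again as the contracted vertex.
  have hKd : ∀ z ∈ K,
      d - 1 ≤ (K.filter (G.Adj z)).card + if ∃ w ∈ B, G.Adj z w then 1 else 0 := by
    intro z hzK
    have hzd := hdeg z (hKS hzK) (fun h => huK (h ▸ hzK))
    have h1 : (∃ w ∈ W, G.Adj z w) → B = W → ∃ w ∈ B, G.Adj z w := by
      rintro h rfl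
      exact h
    have h2 : (S.filter (G.Adj z)).card ≤ (K.filter (G.Adj z)).card + 1 +
        (if (∃ w ∈ B, G.Adj z w) ∧ B ≠ W then 1 else 0) := by
      by_cases hBW : B = W
      · subst hBW
        have : S.filter (G.Adj z) ⊆ insert u (K.filter (G.Adj z)) := by
          intro c hc
          rw [Finset.mem_filter] at hc
          rcases hexit z hzK c (Or.inl hc.1) hc.2 with h | h | h
          · simp [h, hc.2]
          · simp [h]
          · exact absurd hc.1 (hWS c h)
        have := (Finset.card_le_card this).trans (Finset.card_insert_le _ _)
        omega
      · obtain ⟨b, hbS, rfl⟩ := hB.resolve_left hBW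
        by_cases hzb : G.Adj z b
        · have : S.filter (G.Adj z) ⊆ insert b (insert u (K.filter (G.Adj z))) := by
            intro c hc
            rw [Finset.mem_filter] at hc
            rcases hexit z hzK c (Or.inl hc.1) hc.2 with h | h | h
            · simp [h, hc.2]
            · simp [h]
            · simp [Set.mem_singleton_iff.1 h]
          have := (Finset.card_le_card this).trans ((Finset.card_insert_le _ _).trans
            (Nat.add_le_add_right (Finset.card_insert_le _ _) 1))
          simpa [hzb, hBW] using this
        · have : S.filter (G.Adj z) ⊆ insert u (K.filter (G.Adj z)) := by
            intro c hc
            rw [Finset.mem_filter] at hc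
            rcases hexit z hzK c (Or.inl hc.1) hc.2 with h | h | h
            · simp [h, hc.2]
            · simp [h]
            · exact absurd (Set.mem_singleton_iff.1 h ▸ hc.2) hzb
          have := (Finset.card_le_card this).trans (Finset.card_insert_le _ _)
          omega
    have h3 : (∃ w ∈ W, G.Adj z w) → B = W := by
      rintro ⟨w, hw, hzw⟩
      by_contra hBW
      obtain ⟨b, hbS, rfl⟩ := hB.resolve_left hBW
      have hwS := hWS w hw
      rcases hexit z hzK w (Or.inr hw) hzw with h | h | h
      · exact hwS (hKS h)
      · exact hwS (h ▸ hu)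
      · exact hwS (Set.mem_singleton_iff.1 h ▸ hbS)
    by_cases hzW : ∃ w ∈ W, G.Adj z w
    · have hBW := h3 hzW
      rw [if_pos hzW] at hzd
      rw [if_neg (fun h => h.2 hBW)] at h2
      rw [if_pos (h1 hzW hBW)]
      omega
    · rw [if_neg hzW] at hzd
      by_cases hzB : ∃ w ∈ B, G.Adj z w
      · rw [if_pos hzB]
        split_ifs at h2 <;> omega
      · rw [if_neg fun h => hzB h.1] at h2
        omega
  have hKdeg := fun z hz (_ : z ≠ u') => hKd z hz
  have hKbase : K = {u'} → d - 1 ≤ 1 ∧ ∃ w ∈ B, G.Adj u' w := by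
    rintro rfl
    constructor
    · have := hKd u' hu'K
      have h0 : ({u'} : Finset V).filter (G.Adj u') = ∅ := by simp
      rw [h0] at this
      simp only [Finset.card_empty] at this
      split_ifs at this <;> omega
    · obtain ⟨a, ha, c, hc, hca, hcu, hac⟩ := hcut {u'} hKS (by simpa using huK) (by simp) u hu
        (by simpa using huK)
      rw [Finset.mem_singleton] at ha hca
      subst ha
      rcases hexit a hu'K c hc hac with h | h | h
      · exact absurd (by simpa using h) hca
      · exact absurd h hcu
      · exact ⟨c, h, hac⟩
  obtain ⟨z, ⟨b, hbB, hzb⟩, l, hl, hdl⟩ := ih K.card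
    (by rw [← hn]; exact Finset.card_lt_card ⟨hKS, fun h => huK (h hu)⟩) (d - 1) K u' B hu'K
    (fun x hx => (hBK x hx).1) hKconn
    (fun A hAK hu'A hAne x hxK hxA => key A hAK hu'A hAne x (hKS hxK) hxA) hKdeg hKbase rfl
  have hul : u ∉ l := fun h => huK (by simpa using hl.sub u h)
  have h1 : IsPathList G (S : Set V) u z (u :: l) := by
    have := ((IsPathList.single (G := G) (S := (S : Set V)) (by simpa using hu)).append
      (hl.mono (Finset.coe_subset.2 hKS)) huu' (by simp; exact hul))
    simpa using this
  rcases hB with rfl | ⟨b', hb'S, rfl⟩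
  · exact ⟨z, ⟨b, hbB, hzb⟩, _, h1, by simp; omega⟩
  · obtain rfl : b = b' := by simpa using hbB
    have hbK := hBK b rfl
    -- The path has stopped next to `b`, and must go on to `W` outside `K` and `u`. If it could not,
    -- the part reachable from `b` together with `K` would have no exit but `u`, against `hcut`.
    obtain ⟨e, he, p, hp⟩ := IsPathList.exists_of_closed (G := G) (b := b)
      (T := {x | x ∈ S ∧ x ≠ u ∧ x ∉ K}) (M := {e | ∃ w ∈ W, G.Adj e w}) ⟨hb'S, hbK.2, hbK.1⟩ (by
        intro A hA hbA hcl
        by_contra! hcon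
        let A' : Finset V := S.filter (fun x => x ∈ A ∨ x ∈ K)
        have hAA' : ∀ x, x ∈ A' ↔ x ∈ A ∨ x ∈ K := by
          intro x
          simp only [A', Finset.mem_filter, and_iff_right_iff_imp]
          rintro (h | h)
          exacts [(hA h).1, hKS h]
        have huA' : u ∉ A' := by
          rw [hAA']
          rintro (h | h)
          exacts [(hA h).2.1 rfl, huK h]
        obtain ⟨a, ha, c, hc, hcA, hcu, hac⟩ := hcut A' (Finset.filter_subset _ _) huA'
          ⟨u', (hAA' _).2 (Or.inr hu'K)⟩ u hu huA'
        rw [hAA'] at ha hcA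
        push Not at hcA
        rcases ha with ha | ha
        · rcases hc with hc | hc
          · exact hcA.1 (hcl a ha c ⟨hc, hcu, hcA.2⟩ hac)
          · exact hcon a ha ⟨c, hc, hac⟩
        · rcases hexit a ha c hc hac with h | h | h
          · exact hcA.2 h
          · exact hcu h
          · rw [Set.mem_singleton_iff] at h
            exact hcA.1 (h ▸ hbA))
    refine ⟨e, he, _, (h1.append hp hzb ?_).mono ?_, by simp; omega⟩
    · intro x hx hxp
      have := hp.sub x hxp
      rcases List.mem_cons.1 hx with rfl | hx
      · exact this.2.1 rfl
      · exact this.2.2 (by simpa using hl.sub x hx)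
    · rintro x (hx | hx)
      exacts [hx, by simpa using hx.1]

end LongPath

/-! ### Long cycles through a prescribed vertex of high degree. -/

/-- Summing the hypothesis over consecutive points of `Y`, each gap contributes 2 and the variations
of `g` add up by the triangle inequality. For `Y` the attachment positions on a cycle, this bounds
its length. -/
theorem two_mul_card_add_abs_sub_le (Y : Finset ℕ) (g : ℕ → ℤ)
    (h : ∀ i ∈ Y, ∀ j ∈ Y, i < j → |g i - g j| + 2 ≤ (j : ℤ) - i) (n m M : ℕ)
    (hn : M - m = n) (hm : m ∈ Y) (hM : M ∈ Y) (hmM : m ≤ M) :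
    2 * ((Y.filter (fun p => m ≤ p ∧ p < M)).card : ℤ) + |g m - g M| ≤ (M : ℤ) - m := by
  induction n using Nat.strong_induction_on generalizing m M with
  | _ n ih =>
  by_cases hex : ∃ p ∈ Y, m < p ∧ p < M
  · obtain ⟨p, hp, hmp, hpM⟩ := hex
    have h1 := ih (p - m) (by omega) m p rfl hm hp hmp.le
    have h2 := ih (M - p) (by omega) p M rfl hp hM hpM.le
    have h3 : Y.filter (fun q => m ≤ q ∧ q < M) ⊆
        Y.filter (fun q => m ≤ q ∧ q < p) ∪ Y.filter (fun q => p ≤ q ∧ q < M) := by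
      intro q
      simp only [Finset.mem_filter, Finset.mem_union]
      rintro ⟨hq, h1, h2⟩
      by_cases hqp : q < p
      · exact Or.inl ⟨hq, h1, hqp⟩
      · exact Or.inr ⟨hq, by omega, h2⟩
    have h4 := (Finset.card_le_card h3).trans (Finset.card_union_le _ _)
    have h5 := abs_sub_le (g m) (g p) (g M)
    omega
  · push Not at hex
    rcases hmM.eq_or_lt with rfl | hlt
    · have : Y.filter (fun q => m ≤ q ∧ q < m) = ∅ := by
        apply Finset.filter_eq_empty_iff.2
        intro q _
        omega
      simp [this]
    · have h1 : Y.filter (fun q => m ≤ q ∧ q < M) ⊆ {m} := by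
        intro q
        simp only [Finset.mem_filter, Finset.mem_singleton]
        rintro ⟨hq, h1, h2⟩
        have := hex q hq
        omega
      have h2 : ((Y.filter (fun q => m ≤ q ∧ q < M)).card : ℤ) ≤ 1 := by
        exact_mod_cast Finset.card_le_card h1
      have := h m hm M hM hlt
      linarith

section CycleList

variable {V : Type*} {G : SimpleGraph V}

/-- Replacing the part of a cycle through `v` strictly between the positions `i < j` by a path
`p` off the cycle. -/
theorem IsPathList.detour {S : Set V} {v x a e : V} {l p : List V}
    (hl : IsPathList G Set.univ v x l) (hxv : G.Adj x v) (hp : IsPathList G S a e p)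
    (hdisj : ∀ z ∈ S, z ∉ l) {i j : ℕ} (hij : i < j) (hj : j ≤ l.length)
    (hia : G.Adj (l[i]?.getD v) a) (hej : G.Adj (l[j]?.getD v) e) :
    ∃ x' l', IsPathList G Set.univ v x' l' ∧ G.Adj x' v ∧
      l'.length = i + 1 + p.length + (l.length - j) := by
  have hi : i < l.length := by omega
  have h1 := (hl.take hi).append hp (by simpa [hi] using hia)
    (fun z hz hzp => hdisj z (hp.sub z hzp) (List.mem_of_mem_take hz))
  -- For `j = l.length` the default value of `getD` makes `v` the second attachment, so the detour
  -- itself closes the cycle.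
  rcases hj.eq_or_lt with rfl | hj
  · exact ⟨e, _, h1.mono (Set.subset_univ _), by simpa using hej.symm, by simp; omega⟩
  · refine ⟨x, _, (h1.append (hl.drop hj) (by simpa [hj] using hej.symm) ?_).mono
      (Set.subset_univ _), hxv, by simp; omega⟩
    intro z hz hzd
    rcases List.mem_append.1 hz with hz | hz
    · have hd := hl.nodup
      rw [← List.take_append_drop (i + 1) l] at hd
      refine (List.nodup_append.1 hd).2.2 z hz z ?_ rfl
      have : l.drop j = (l.drop (i + 1)).drop (j - (i + 1)) := by
        rw [List.drop_drop]; congr 1; omega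
      rw [this] at hzd
      exact List.mem_of_mem_drop hzd
    · exact hdisj z (hp.sub z hz) (List.mem_of_mem_drop hzd)

open Classical in
/-- In a two-connected graph of minimum degree at least `d`, each vertex of degree at least
`k - 1`, where `k ≤ 2 * d`, lies on a cycle of length at least `k`. -/
theorem exists_cycle_list_of_two_connected [Fintype V] (d k : ℕ) (v : V) (hk3 : 3 ≤ k)
    (hkd : k ≤ 2 * d)
    (hcut : ∀ (x : V) (A : Finset V), A.Nonempty → x ∉ A → (∃ y, y ≠ x ∧ y ∉ A) →
      ∃ a ∈ A, ∃ b, b ∉ A ∧ b ≠ x ∧ G.Adj a b)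
    (hdeg : ∀ x, d ≤ (Finset.univ.filter (G.Adj x)).card)
    (hv : k ≤ (Finset.univ.filter (G.Adj v)).card + 1) :
    ∃ x l, IsPathList G Set.univ v x l ∧ G.Adj x v ∧ k ≤ l.length := by
  by_contra! hcon
  -- a longest cycle through `v`
  obtain ⟨x, l, hl, hxv, hmax⟩ : ∃ x l, IsPathList G Set.univ v x l ∧ G.Adj x v ∧
      ∀ x' l', IsPathList G Set.univ v x' l' → G.Adj x' v → l'.length ≤ l.length := by
    let P : ℕ → Prop := fun n => ∃ x l, IsPathList G Set.univ v x l ∧ G.Adj x v ∧ l.length = n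
    obtain ⟨a, ha⟩ : (Finset.univ.filter (G.Adj v)).Nonempty := by
      rw [← Finset.card_pos]; omega
    have hva : G.Adj v a := by simpa using ha
    -- A single edge counts as a cycle of length 2, so that a longest one exists.
    have h2 : P 2 := by
      refine ⟨a, [v, a], ⟨?_, ?_, by simp, by simp, by simp⟩, hva.symm, rfl⟩
      · simpa using hva
      · simpa using hva.ne
    obtain ⟨x, l, hl, hxv, hlen⟩ := Nat.findGreatest_spec (P := P) (n := k) (by omega) h2
    refine ⟨x, l, hl, hxv, fun x' l' hl' hxv' => ?_⟩
    rw [hlen]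
    exact Nat.le_findGreatest (hcon x' l' hl' hxv').le ⟨x', l', hl', hxv', rfl⟩
  have hlk := hcon x l hl hxv
  have hvl : v ∈ l := hl.mem_head
  have hl0 : l[0]?.getD v = v := by
    have h0 := hl.length_pos
    simp [h0, hl.getElem_zero h0]
  -- a neighbour of `v` off the cycle, and its component
  obtain ⟨w, hvw, hwl⟩ : ∃ w, G.Adj v w ∧ w ∉ l := by
    by_contra! hall
    have hsub : Finset.univ.filter (G.Adj v) ⊆ l.toFinset.erase v := by
      intro w hw
      have hw : G.Adj v w := by simpa using hw
      simp [hall w hw, hw.ne']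
    have h1 := Finset.card_le_card hsub
    rw [Finset.card_erase_of_mem (by simpa using hvl)] at h1
    have h2 := List.toFinset_card_le l
    omega
  obtain ⟨H, ⟨hwH, hHl, hHcl⟩, hHmin⟩ : ∃ H : Finset V,
      (w ∈ H ∧ (∀ a ∈ H, a ∉ l) ∧ ∀ a ∈ H, ∀ b, b ∉ l → G.Adj a b → b ∈ H) ∧
      ∀ H' : Finset V,
        (w ∈ H' ∧ (∀ a ∈ H', a ∉ l) ∧ ∀ a ∈ H', ∀ b, b ∉ l → G.Adj a b → b ∈ H') →
        H.card ≤ H'.card := by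
    obtain ⟨K, hK, hm⟩ := WellFounded.has_min (measure (Finset.card : Finset V → ℕ)).wf
      {H : Finset V | w ∈ H ∧ (∀ a ∈ H, a ∉ l) ∧ ∀ a ∈ H, ∀ b, b ∉ l → G.Adj a b → b ∈ H}
      ⟨Finset.univ.filter (· ∉ l), by simp [hwl], by simp, by simp; tauto⟩
    exact ⟨K, hK, fun K' hK' => not_lt.1 (hm K' hK')⟩
  have hconn : ∀ A ⊆ H, A.Nonempty → A ≠ H → ∃ a ∈ A, ∃ b ∈ H, b ∉ A ∧ G.Adj a b := by
    intro A hAH hAne hA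
    by_contra! hno
    have hlt : A.card < H.card :=
      Finset.card_lt_card (Finset.ssubset_iff_subset_ne.2 ⟨hAH, hA⟩)
    by_cases hwA : w ∈ A
    · have := hHmin A ⟨hwA, fun a ha => hHl a (hAH ha), fun a ha b hb hab => by
        by_contra hbA
        exact hno a ha b (hHcl a (hAH ha) b hb hab) hbA hab⟩
      omega
    · have := hHmin (H \ A) ⟨by simp [hwH, hwA],
        fun a ha => hHl a (Finset.sdiff_subset ha), fun a ha b hb hab => by
          rw [Finset.mem_sdiff] at ha ⊢
          refine ⟨hHcl a ha.1 b hb hab, fun hbA => hno b hbA a ha.1 ha.2 hab.symm⟩⟩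
      have h1 := Finset.card_sdiff_of_subset hAH
      have h2 := hAne.card_pos
      omega
  have hHcut : ∀ A ⊆ H, A.Nonempty → ∀ x', x' ∉ A →
      ∃ a ∈ A, ∃ b, (b ∈ H ∨ b ∈ l) ∧ b ∉ A ∧ b ≠ x' ∧ G.Adj a b := by
    intro A hAH hAne x' hx'
    obtain ⟨a, ha, b, hbA, hbx, hab⟩ := hcut x' A hAne hx' (by
      by_cases hvx : v = x'
      · exact ⟨x, fun h => hxv.ne (h.trans hvx.symm), fun h => hHl x (hAH h) hl.mem_last⟩
      · exact ⟨v, hvx, fun h => hHl v (hAH h) hvl⟩)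
    refine ⟨a, ha, b, ?_, hbA, hbx, hab⟩
    by_cases hbl : b ∈ l
    · exact Or.inr hbl
    · exact Or.inl (hHcl a (hAH ha) b hbl hab)
  -- By maximality an arc has at least as many inner vertices as a path of `H` that could replace
  -- it. As `v` sits at positions `0` and `l.length`, no detour removes it.
  have hdetour : ∀ {a e : V} {p : List V}, IsPathList G (H : Set V) a e p → ∀ {i j : ℕ},
      i < j → j ≤ l.length → G.Adj (l[i]?.getD v) a → G.Adj (l[j]?.getD v) e →
      i + 1 + p.length ≤ j := by
    intro a e p hp i j hij hj hia hej
    obtain ⟨x', l', hl', hxv', hlen⟩ := hl.detour hxv hp (by simpa using hHl) hij hj hia hej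
    have := hmax x' l' hl' hxv'
    omega
  have hHdeg : ∀ z ∈ H, d ≤ (H.filter (G.Adj z)).card + (l.toFinset.filter (G.Adj z)).card := by
    intro z hz
    refine (hdeg z).trans ((Finset.card_le_card ?_).trans (Finset.card_union_le _ _))
    intro b hb
    have hzb : G.Adj z b := by simpa using hb
    by_cases hbl : b ∈ l
    · simp [hbl, hzb]
    · simp [hHcl z hz b hbl hzb, hzb]
  obtain ⟨y, hyH, hymax⟩ := Finset.exists_max_image H
    (fun y => (l.toFinset.filter (G.Adj y)).card) ⟨w, hwH⟩
  -- With at most one neighbour on the cycle, vertices of `H` lose no degree when the cycle minus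
  -- `v` is contracted, so some path from `v` through `H` back to the cycle has `d - 1` vertices in
  -- `H`.
  by_cases ht : (l.toFinset.filter (G.Adj y)).card ≤ 1
  · obtain ⟨z, ⟨b, ⟨hbl, hbv⟩, hzb⟩, p, hp, hdp⟩ := exists_long_path_to (G := G) d (insert v H) v
      {b | b ∈ l ∧ b ≠ v} (Finset.mem_insert_self _ _)
      (by
        rintro b ⟨hbl, hbv⟩ hb
        rcases Finset.mem_insert.1 hb with h | h
        · exact hbv h
        · exact hHl b h hbl)
      (by
        intro A hA hvA hAne
        have hAH : A ⊆ H := (Finset.subset_insert_iff_of_notMem hvA).1 hA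
        by_cases hAe : A = H
        · exact ⟨w, hAe ▸ hwH, v, by simp, hvA, hvw.symm⟩
        · obtain ⟨a, ha, b, hb, hbA, hab⟩ := hconn A hAH hAne hAe
          exact ⟨a, ha, b, by simp [hb], hbA, hab⟩)
      (by
        intro A hA hvA hAne x' _ hx'
        have hAH : A ⊆ H := (Finset.subset_insert_iff_of_notMem hvA).1 hA
        obtain ⟨a, ha, b, hb, hbA, hbx, hab⟩ := hHcut A hAH hAne x' hx'
        refine ⟨a, ha, b, ?_, hbA, hbx, hab⟩
        by_cases hbv : b = v
        · exact Or.inl (by simp [hbv])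
        · rcases hb with hb | hb
          · exact Or.inl (by simp [hb])
          · exact Or.inr ⟨hb, hbv⟩)
      (by
        intro z hz hzv
        have hzH : z ∈ H := (Finset.mem_insert.1 hz).resolve_left hzv
        have h1 := hHdeg z hzH
        have h2 := hymax z hzH
        by_cases hW : ∃ b ∈ {b | b ∈ l ∧ b ≠ v}, G.Adj z b
        · have h3 : (H.filter (G.Adj z)).card ≤ ((insert v H).filter (G.Adj z)).card :=
            Finset.card_le_card (Finset.filter_subset_filter _ (Finset.subset_insert _ _))
          rw [if_pos hW]
          omega
        · have h3 : H.filter (G.Adj z) ∪ l.toFinset.filter (G.Adj z) ⊆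
              (insert v H).filter (G.Adj z) := by
            intro b hb
            simp only [Finset.mem_union, Finset.mem_filter, List.mem_toFinset] at hb
            rw [Finset.mem_filter, Finset.mem_insert]
            rcases hb with hb | hb
            · exact ⟨Or.inr hb.1, hb.2⟩
            · refine ⟨Or.inl ?_, hb.2⟩
              by_contra hbv
              exact hW ⟨b, ⟨hb.1, hbv⟩, hb.2⟩
          have h4 := Finset.card_le_card h3
          rw [Finset.card_union_of_disjoint] at h4
          · omega
          · rw [Finset.disjoint_left]
            intro b hb hb'
            simp only [Finset.mem_filter, List.mem_toFinset] at hb hb'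
            exact hHl b hb.1 hb'.1)
      (by
        intro h
        have : w ∈ ({v} : Finset V) := h ▸ Finset.mem_insert_of_mem hwH
        exact absurd (Finset.mem_singleton.1 this) hvw.ne')
    have hp1 : 1 < p.length := by omega
    have hp0 : p[0] = v := hp.getElem_zero (by omega)
    have hpd := hp.drop hp1
    have hpH : IsPathList G (H : Set V) p[1] z (p.drop 1) := by
      refine ⟨hpd.chain, hpd.nodup, hpd.head, hpd.last, fun a ha => ?_⟩
      have haS := hpd.sub a ha
      have hav : a ≠ v := by
        rintro rfl
        obtain ⟨i, hi, hia⟩ := List.getElem_of_mem ha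
        rw [List.getElem_drop, ← hp0, hp.nodup.getElem_inj_iff] at hia
        omega
      simpa [hav] using haS
    obtain ⟨j, hj, rfl⟩ := List.getElem_of_mem hbl
    have hj0 : 0 < j := by
      rcases Nat.eq_zero_or_pos j with rfl | h
      · exact absurd (hl.getElem_zero hj) hbv
      · exact h
    have hvp : G.Adj v p[1] := by
      have := hp.chain.getElem 0 hp1
      simpa [hp0] using this
    -- Both arcs between `v` and `b` have length at least `d`, hence the cycle has length at least
    -- `2 * d`.
    have h1 := hdetour hpH hj0 hj.le (by rwa [hl0]) (by simpa [hj] using hzb.symm)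
    have h2 := hdetour hpH.reverse hj le_rfl (by simpa [hj] using hzb.symm) (by simpa using hvp)
    simp only [List.length_drop, List.length_reverse] at h1 h2
    omega
  -- Vertices of `H` have at most `t` neighbours on the cycle, so contracting it costs at most `t -
  -- 1` in degree.
  · set t := (l.toFinset.filter (G.Adj y)).card
    obtain ⟨z, ⟨b, hbl, hzb⟩, p, hp, hdp⟩ := exists_long_path_to (G := G) (d + 1 - t) H y
      {b | b ∈ l} hyH (fun b hb hbH => hHl b hbH hb)
      (by
        intro A hA hyA hAne
        exact hconn A hA hAne (fun h => hyA (h ▸ hyH)))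
      (fun A hA _ hAne x' _ hx' => hHcut A hA hAne x' hx')
      (by
        intro z hz _
        have h1 := hHdeg z hz
        have h2 := hymax z hz
        by_cases hW : ∃ b ∈ {b | b ∈ l}, G.Adj z b
        · rw [if_pos hW]
          omega
        · have h3 : l.toFinset.filter (G.Adj z) = ∅ := by
            rw [Finset.filter_eq_empty_iff]
            intro b hb hzb
            exact hW ⟨b, by simpa using hb, hzb⟩
          rw [h3, Finset.card_empty] at h1
          omega)
      (by
        intro h
        have h1 := hHdeg y hyH
        rw [h] at h1
        have h0 : ({y} : Finset V).filter (G.Adj y) = ∅ := by simp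
        rw [h0, Finset.card_empty] at h1
        refine ⟨by omega, ?_⟩
        obtain ⟨b, hb⟩ : (l.toFinset.filter (G.Adj y)).Nonempty := by
          rw [← Finset.card_pos]; omega
        simp only [Finset.mem_filter, List.mem_toFinset] at hb
        exact ⟨b, hb⟩)
    have hconn' : ∀ A ⊆ (H : Set V), A.Nonempty → A ≠ H →
        ∃ a ∈ A, ∃ b ∈ (H : Set V), b ∉ A ∧ G.Adj a b := by
      intro A hA hAne hAH
      have hf : (H.filter (· ∈ A) : Finset V) = A := by
        ext a
        simp only [Finset.coe_filter, Set.mem_ofPred_eq, and_iff_right_iff_imp]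
        exact fun h => hA h
      have := hconn (H.filter (· ∈ A)) (Finset.filter_subset _ _)
        (by rwa [← Finset.coe_nonempty, hf]) (fun h => hAH (by rw [← hf, h]))
      obtain ⟨a, ha, b, hb, hbA, hab⟩ := this
      rw [← Finset.mem_coe, hf] at ha hbA
      exact ⟨a, ha, b, hb, hbA, hab⟩
    obtain ⟨i, hi, l₁, l₂, hl₁, hl₂, hlen₁, hlen₂⟩ := hp.tripod hconn' (w := w) hwH
    -- levels of the attachments
    let level : V → ℤ := fun u => if u = b then (p.length : ℤ) - 1 else if G.Adj y u then 0 else i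
    -- The level of a cycle vertex locates its attachment along `p`: `z` for `b`, `y` for neighbours
    -- of `y`, and `w` for `v` otherwise. The vertex `v` occurs in `Y` twice, as `0` and as
    -- `l.length`.
    let Y : Finset ℕ := (Finset.range (l.length + 1)).filter
      (fun j => G.Adj y (l[j]?.getD v) ∨ l[j]?.getD v = b ∨ l[j]?.getD v = v)
    have hdet : ∀ u u' : V, (G.Adj y u ∨ u = b ∨ u = v) → (G.Adj y u' ∨ u' = b ∨ u' = v) →
        ∃ a e h, IsPathList G (H : Set V) a e h ∧ G.Adj u a ∧ G.Adj u' e ∧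
          |level u - level u'| + 1 ≤ h.length := by
      have hzH : z ∈ (H : Set V) := hp.sub z hp.mem_last
      have hbz := hzb.symm
      have hll₁ : (i : ℤ) + 1 ≤ l₁.length := by exact_mod_cast hlen₁
      have hll₂ : (p.length : ℤ) ≤ l₂.length + i := by exact_mod_cast hlen₂
      have hii : (i : ℤ) < p.length := by exact_mod_cast hi
      have key : ∀ n n' : ℤ, ∀ m : ℕ, n - n' + 1 ≤ m → n' - n + 1 ≤ m → |n - n'| + 1 ≤ m := by
        intro n n' m h1 h2
        have : |n - n'| ≤ m - 1 := abs_le.2 ⟨by omega, by omega⟩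
        omega
      intro u u' hu hu'
      simp only [level]
      have hu3 : u ≠ b → ¬ G.Adj y u → G.Adj u w := by
        intro h1 h2
        rw [(hu.resolve_left h2).resolve_left h1]; exact hvw
      have hu3' : u' ≠ b → ¬ G.Adj y u' → G.Adj u' w := by
        intro h1 h2
        rw [(hu'.resolve_left h2).resolve_left h1]; exact hvw
      by_cases h1 : u = b
      · subst h1
        rw [if_pos rfl]
        by_cases h1' : u' = u
        · subst h1'
          exact ⟨z, z, [z], IsPathList.single hzH, hbz, hbz, by simp⟩
        · rw [if_neg h1']
          by_cases h2' : G.Adj y u'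
          · rw [if_pos h2']
            exact ⟨z, y, _, hp.reverse, hbz, h2'.symm,
              key _ _ _ (by simp) (by simp; omega)⟩
          · rw [if_neg h2']
            exact ⟨z, w, _, hl₂.reverse, hbz, hu3' h1' h2',
              key _ _ _ (by simp; omega) (by simp; omega)⟩
      · rw [if_neg h1]
        by_cases h2 : G.Adj y u
        · rw [if_pos h2]
          by_cases h1' : u' = b
          · subst h1'
            rw [if_pos rfl]
            exact ⟨y, z, _, hp, h2.symm, hbz, key _ _ _ (by omega) (by omega)⟩
          · rw [if_neg h1']
            by_cases h2' : G.Adj y u'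
            · rw [if_pos h2']
              exact ⟨y, y, [y], IsPathList.single hyH, h2.symm, h2'.symm, by simp⟩
            · rw [if_neg h2']
              exact ⟨y, w, _, hl₁.reverse, h2.symm, hu3' h1' h2',
                key _ _ _ (by simp; omega) (by simp; omega)⟩
        · rw [if_neg h2]
          by_cases h1' : u' = b
          · subst h1'
            rw [if_pos rfl]
            exact ⟨w, z, _, hl₂, hu3 h1 h2, hbz, key _ _ _ (by omega) (by omega)⟩
          · rw [if_neg h1']
            by_cases h2' : G.Adj y u'
            · rw [if_pos h2']
              exact ⟨w, y, _, hl₁, hu3 h1 h2, h2'.symm, key _ _ _ (by omega) (by omega)⟩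
            · rw [if_neg h2']
              exact ⟨w, w, [w], IsPathList.single hwH, hu3 h1 h2, hu3' h1' h2', by simp⟩
    have hgap := two_mul_card_add_abs_sub_le Y (fun j => level (l[j]?.getD v)) (by
      intro j₁ hj₁ j₂ hj₂ hlt
      simp only [Y, Finset.mem_filter, Finset.mem_range] at hj₁ hj₂
      obtain ⟨a, e, h, hh, hua, hue, hlev⟩ := hdet _ _ hj₁.2 hj₂.2
      have := hdetour hh hlt (by omega) hua hue
      omega)
    have h0Y : 0 ∈ Y := by simp [Y, hl0]
    have hcY : l.length ∈ Y := by simp [Y]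
    obtain ⟨pb, hpb, hpbb⟩ := List.getElem_of_mem hbl
    obtain ⟨b', hb', hb'b⟩ := Finset.exists_mem_ne (s := l.toFinset.filter (G.Adj y)) (by omega) b
    simp only [Finset.mem_filter, List.mem_toFinset] at hb'
    obtain ⟨q, hq, hqb⟩ := List.getElem_of_mem hb'.1
    have hpb' : l[pb]?.getD v = b := by simp [hpb, hpbb]
    have hq' : l[q]?.getD v = b' := by simp [hq, hqb]
    have hpbY : pb ∈ Y := by simp [Y, hpb']; omega
    have hqY : q ∈ Y := by simp [Y, hq', hb'.2]; omega
    have hlb : level b = (p.length : ℤ) - 1 := if_pos rfl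
    have hlb' : level b' = 0 := by simp only [level]; rw [if_neg hb'b, if_pos hb'.2]
    have hcard : t ≤ (Y.filter (fun j => j < l.length)).card := by
      have : l.toFinset.filter (G.Adj y) ⊆
          (Y.filter (fun j => j < l.length)).image (fun j => l[j]?.getD v) := by
        intro u hu
        simp only [Finset.mem_filter, List.mem_toFinset] at hu
        obtain ⟨j, hj, hju⟩ := List.getElem_of_mem hu.1
        have hju' : l[j]?.getD v = u := by simp [hj, hju]
        refine Finset.mem_image.2 ⟨j, ?_, hju'⟩
        simp only [Y, Finset.mem_filter, Finset.mem_range, hju', hu.2, true_or, and_true]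
        omega
      exact (Finset.card_le_card this).trans Finset.card_image_le
    -- Going once around from `v` to `v`, the level changes by at least `p.length - 1` between `p₁`
    -- and `p₂` and by as much in total on the rest. With at least `t` gaps, the length is at least
    -- `2 * t + 2 * (d - t)`.
    have hfinal : ∀ p₁ p₂, p₁ ∈ Y → p₂ ∈ Y → p₁ ≤ p₂ → p₂ < l.length →
        (p.length : ℤ) - 1 ≤ |level (l[p₁]?.getD v) - level (l[p₂]?.getD v)| → False := by
      intro p₁ p₂ h₁ h₂ h12 hc hlev
      have g1 := hgap _ 0 p₁ rfl h0Y h₁ (Nat.zero_le _)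
      have g2 := hgap _ p₁ p₂ rfl h₁ h₂ h12
      have g3 := hgap _ p₂ l.length rfl h₂ hcY hc.le
      have hsub : Y.filter (fun j => j < l.length) ⊆
          Y.filter (fun j => 0 ≤ j ∧ j < p₁) ∪ (Y.filter (fun j => p₁ ≤ j ∧ j < p₂) ∪
            Y.filter (fun j => p₂ ≤ j ∧ j < l.length)) := by
        intro j
        simp only [Finset.mem_union, Finset.mem_filter]
        rintro ⟨hj, hjc⟩
        simp only [hj, true_and]
        omega
      have hcc := (Finset.card_le_card hsub).trans ((Finset.card_union_le _ _).trans
        (Nat.add_le_add_left (Finset.card_union_le _ _) _))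
      have hlc : l[l.length]?.getD v = v := by simp
      simp only [hl0, hlc] at g1 g2 g3
      have ht1 := abs_sub_le (level (l[p₁]?.getD v)) (level v) (level (l[p₂]?.getD v))
      rw [abs_sub_comm (level (l[p₁]?.getD v)) (level v),
        abs_sub_comm (level v) (level (l[p₂]?.getD v))] at ht1
      omega
    rcases le_total pb q with h | h
    · refine hfinal pb q hpbY hqY h hq ?_
      rw [hpb', hq', hlb, hlb', sub_zero]
      exact le_abs_self _
    · refine hfinal q pb hqY hpbY h hpb ?_
      rw [hpb', hq', hlb, hlb', zero_sub, abs_neg]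
      exact le_abs_self _

end CycleList

/-! ### Reduction to a two-connected subgraph, and shortening of cycles. -/

section Reduction

variable {V : Type*} {G : SimpleGraph V}

open Classical in
/-- A graph on `n` vertices with more than `(k - 1)(n - 1) / 2` edges contains a cycle of length
at least `k` through a vertex of degree at least `k - 1`. -/
theorem exists_cycle_list_through_heavy_vertex [Fintype V] [Nonempty V] (k : ℕ) (hk3 : 3 ≤ k)
    (hG : (k - 1) * (Fintype.card V - 1) < ∑ x, (Finset.univ.filter (G.Adj x)).card) :
    ∃ v x l, IsPathList G Set.univ v x l ∧ G.Adj x v ∧ k ≤ l.length ∧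
      k ≤ (Finset.univ.filter (G.Adj v)).card + 1 := by
  let D : Finset V → ℕ := fun S => ∑ x ∈ S, (S.filter (G.Adj x)).card
  have hD : ∀ S, D S = ∑ x ∈ S, ∑ y ∈ S, if G.Adj x y then 1 else 0 := by
    intro S
    simp only [D, Finset.card_filter]
  obtain ⟨S, ⟨hSne, hS⟩, hmin⟩ : ∃ S : Finset V, (S.Nonempty ∧ (k - 1) * (S.card - 1) < D S) ∧
      ∀ S' : Finset V, (S'.Nonempty ∧ (k - 1) * (S'.card - 1) < D S') → S.card ≤ S'.card := by
    obtain ⟨K, hK, hm⟩ := WellFounded.has_min (measure (Finset.card : Finset V → ℕ)).wf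
      {S : Finset V | S.Nonempty ∧ (k - 1) * (S.card - 1) < D S}
      ⟨Finset.univ, Finset.univ_nonempty, by simpa [D] using hG⟩
    exact ⟨K, hK, fun K' hK' => not_lt.1 (hm K' hK')⟩
  have hsmall : ∀ S' : Finset V, S'.Nonempty → S'.card < S.card →
      D S' ≤ (k - 1) * (S'.card - 1) := by
    intro S' h1 h2
    by_contra! h3
    exact absurd (hmin S' ⟨h1, h3⟩) (by omega)
  have hdegS : ∀ x ∈ S, (S.filter (G.Adj x)).card ≤ S.card - 1 := by
    intro x hx
    rw [← Finset.card_erase_of_mem hx]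
    refine Finset.card_le_card fun y hy => ?_
    rw [Finset.mem_filter] at hy
    exact Finset.mem_erase.2 ⟨hy.2.ne', hy.1⟩
  have hkS : k ≤ S.card := by
    have h1 : D S ≤ S.card * (S.card - 1) := Finset.sum_le_card_nsmul _ _ _ hdegS
    have h2 := Nat.lt_of_mul_lt_mul_right (hS.trans_le h1)
    omega
  have hmul : ∀ a b : ℕ, (k - 1) * a + (k - 1) * b = (k - 1) * (a + b) :=
    fun a b => (mul_add _ _ _).symm
  -- minimum degree
  have hmindeg : ∀ x ∈ S, (k + 1) / 2 ≤ ((S.filter (G.Adj x)).card) := by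
    intro x hx
    have h1 := hsmall (S.erase x)
      (by rw [← Finset.card_pos, Finset.card_erase_of_mem hx]; omega)
      (Finset.card_erase_lt_of_mem hx)
    have h2 : D S = D (S.erase x) + 2 * (S.filter (G.Adj x)).card := by
      have h3 : ∀ f : V → ℕ, ∑ y ∈ S, f y = f x + ∑ y ∈ S.erase x, f y :=
        fun f => (Finset.add_sum_erase S f hx).symm
      have h4 : (S.filter (G.Adj x)).card = ∑ y ∈ S.erase x, if G.Adj x y then 1 else 0 := by
        rw [Finset.card_filter, h3]; simp
      have h5 : (S.filter (G.Adj x)).card = ∑ y ∈ S.erase x, if G.Adj y x then 1 else 0 := by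
        rw [h4]; simp only [G.adj_comm]
      rw [hD, hD, h3, ← Finset.card_filter]
      simp only [h3 (fun z => if G.Adj _ z then 1 else 0), Finset.sum_add_distrib]
      rw [← h5]
      ring
    rw [Finset.card_erase_of_mem hx] at h1
    have h3 := hmul (S.card - 1 - 1) 1
    rw [show S.card - 1 - 1 + 1 = S.card - 1 by omega] at h3
    omega
  -- no cut vertex
  have hcutS : ∀ x ∈ S, ∀ A ⊆ S, A.Nonempty → x ∉ A → (∃ y ∈ S, y ≠ x ∧ y ∉ A) →
      ∃ a ∈ A, ∃ b ∈ S, b ∉ A ∧ b ≠ x ∧ G.Adj a b := by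
    intro x hx A hA hAne hxA hy
    by_contra! hno
    obtain ⟨y, hyS, hyx, hyA⟩ := hy
    set B := (S \ A).erase x with hB
    have hxB : x ∉ B := Finset.notMem_erase _ _
    have hxSA : x ∈ S \ A := Finset.mem_sdiff.2 ⟨hx, hxA⟩
    have hAB : Disjoint A B := by
      rw [Finset.disjoint_left]
      intro a ha hb
      exact (Finset.mem_sdiff.1 (Finset.mem_of_mem_erase hb)).2 ha
    have hyB : y ∈ B := Finset.mem_erase.2 ⟨hyx, Finset.mem_sdiff.2 ⟨hyS, hyA⟩⟩
    have hSe : S = insert x (A ∪ B) := by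
      ext z
      simp only [hB, Finset.mem_insert, Finset.mem_union, Finset.mem_erase, Finset.mem_sdiff]
      constructor
      · tauto
      · rintro (rfl | h | h)
        exacts [hx, hA h, h.2.1]
    have hxAB : x ∉ A ∪ B := by simp [hxA, hxB]
    have hcard : S.card = A.card + B.card + 1 := by
      rw [hSe, Finset.card_insert_of_notMem hxAB, Finset.card_union_of_disjoint hAB]
    have hBpos : 0 < B.card := Finset.card_pos.2 ⟨y, hyB⟩
    have hApos : 0 < A.card := hAne.card_pos
    have h1 := hsmall (insert x A) (Finset.insert_nonempty _ _)
      (by rw [Finset.card_insert_of_notMem hxA]; omega)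
    have h2 := hsmall (insert x B) (Finset.insert_nonempty _ _)
      (by rw [Finset.card_insert_of_notMem hxB]; omega)
    rw [Finset.card_insert_of_notMem hxA] at h1
    rw [Finset.card_insert_of_notMem hxB] at h2
    have hzero : ∀ a ∈ A, ∀ b ∈ B, ¬ G.Adj a b := fun a ha b hb => by
      have hb' := Finset.mem_erase.1 hb
      have hb'' := Finset.mem_sdiff.1 hb'.2
      exact hno a ha b hb''.1 hb''.2 hb'.1
    have hz1 : ∑ a ∈ A, ∑ b ∈ B, (if G.Adj a b then 1 else 0) = 0 :=
      Finset.sum_eq_zero fun a ha => Finset.sum_eq_zero fun b hb => if_neg (hzero a ha b hb)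
    have hz2 : ∑ b ∈ B, ∑ a ∈ A, (if G.Adj b a then 1 else 0) = 0 :=
      Finset.sum_eq_zero fun b hb => Finset.sum_eq_zero fun a ha =>
        if_neg fun h => hzero a ha b hb h.symm
    -- The two sides share only `x` and no edge joins `A` to `B`, so both `D` and the bound `(k -
    -- 1)(|·| - 1)` are additive, and one side would violate minimality.
    have h3 : D S = D (insert x A) + D (insert x B) := by
      rw [hD, hD, hD, hSe]
      simp only [Finset.sum_insert hxAB, Finset.sum_insert hxA, Finset.sum_insert hxB,
        Finset.sum_union hAB, Finset.sum_add_distrib, hz1, hz2, SimpleGraph.irrefl, if_false]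
      ring
    have h4 := hmul A.card B.card
    simp only [Nat.add_sub_cancel] at h1 h2
    rw [hcard, Nat.add_sub_cancel] at hS
    omega
  -- a heavy vertex
  obtain ⟨v, hvS, hv⟩ : ∃ v ∈ S, k ≤ (S.filter (G.Adj v)).card + 1 := by
    by_contra! hno
    have h1 : D S ≤ S.card * (k - 2) := Finset.sum_le_card_nsmul _ _ _ fun x hx => by
      have := hno x hx
      omega
    obtain ⟨k', rfl⟩ : ∃ k', k = k' + 2 := ⟨k - 2, by omega⟩
    obtain ⟨s, hs⟩ : ∃ s, S.card = s + 1 := ⟨S.card - 1, by omega⟩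
    rw [hs] at h1 hS hkS
    simp only [Nat.add_sub_cancel, show k' + 2 - 1 = k' + 1 by omega] at h1 hS
    -- The inequality `|S|(k - 2) ≤ (k - 1)(|S| - 1)` amounts to `|S| ≥ k - 1`.
    nlinarith
  have hcardS : ∀ x : (S : Set V), (Finset.univ.filter ((G.induce (S : Set V)).Adj x)).card =
      (S.filter (G.Adj x)).card := by
    intro x
    rw [← Finset.card_map (Function.Embedding.subtype (· ∈ (S : Set V)))]
    congr 1
    ext y
    simp
    tauto
  obtain ⟨x, l, hl, hxv, hlk⟩ := exists_cycle_list_of_two_connected (G := G.induce (S : Set V))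
    ((k + 1) / 2) k ⟨v, hvS⟩ hk3 (by omega)
    (by
      rintro ⟨x, hx⟩ A hAne hxA ⟨⟨y, hy⟩, hyx, hyA⟩
      have hmem : ∀ z, z ∈ A.map (Function.Embedding.subtype (· ∈ (S : Set V))) ↔
          ∃ h : z ∈ S, (⟨z, h⟩ : (S : Set V)) ∈ A := by
        intro z
        simp
      obtain ⟨a, ha, b, hb, hbA, hbx, hab⟩ := hcutS x hx
        (A.map (Function.Embedding.subtype (· ∈ (S : Set V))))
        (fun z hz => ((hmem z).1 hz).1) (by simpa using hAne)
        (fun h => hxA ((hmem x).1 h).2)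
        ⟨y, hy, fun h => hyx (Subtype.ext h), fun h => hyA ((hmem y).1 h).2⟩
      obtain ⟨haS, haA⟩ := (hmem a).1 ha
      exact ⟨⟨a, haS⟩, haA, ⟨b, hb⟩, fun h => hbA ((hmem b).2 ⟨hb, h⟩),
        fun h => hbx (congrArg Subtype.val h), hab⟩)
    (fun x => (hmindeg x x.2).trans_eq (by convert (hcardS x).symm))
    (hv.trans_eq (by convert congrArg (· + 1) (hcardS ⟨v, hvS⟩).symm))
  refine ⟨v, x, l.map Subtype.val, ⟨?_, hl.nodup.map Subtype.val_injective, ?_, ?_, by simp⟩, hxv,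
    by simpa using hlk, hv.trans (Nat.add_le_add_right (Finset.card_le_card
      (Finset.filter_subset_filter _ (Finset.subset_univ _))) 1)⟩
  · rw [List.isChain_map]
    exact hl.chain.imp fun _ _ h => h
  · rw [List.head?_map, hl.head, Option.map_some]
  · rw [List.getLast?_map, hl.last, Option.map_some]

open Classical in
/-- A vertex with at least `m - 1 + r` neighbours on a cycle of length at least `m` lies on such a
cycle avoiding `r` of its neighbours. -/
theorem exists_cycle_list_with_neighbors_off [Fintype V] (m r : ℕ) (hm : 3 ≤ m) {v x : V}
    {l : List V} (hl : IsPathList G Set.univ v x l) (hxv : G.Adj x v) (hml : m ≤ l.length)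
    (hv : m + r ≤ (Finset.univ.filter (G.Adj v)).card + 1) :
    ∃ x l, IsPathList G Set.univ v x l ∧ G.Adj x v ∧ m ≤ l.length ∧
      r ≤ ((Finset.univ.filter (G.Adj v)).filter (· ∉ l)).card := by
  induction hn : l.length using Nat.strong_induction_on generalizing l x with
  | _ n ih =>
  -- A chord at `v` that cuts off a shorter cycle of length still at least `m` allows induction.
  by_cases hshort : ∃ i, ∃ hi : i < l.length, i + 1 < l.length ∧ m ≤ i + 1 ∧ G.Adj l[i] v
  · obtain ⟨i, hi, hil, hmi, hadj⟩ := hshort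
    have hlen : (l.take (i + 1)).length = i + 1 := by simp; omega
    exact ih _ (by omega) (hl.take hi) hadj (by omega) rfl
  · push Not at hshort
    refine ⟨x, l, hl, hxv, hml, ?_⟩
    -- Without such a chord, neighbours of `v` on the cycle are `x` or at positions `1, ..., m - 2`:
    -- at most `m - 1` in all.
    have hsub : (Finset.univ.filter (G.Adj v)).filter (· ∈ l) ⊆
        insert x ((Finset.Ico 1 (m - 1)).image (fun i => l[i]?.getD v)) := by
      intro u hu
      simp only [Finset.mem_filter, Finset.mem_univ, true_and] at hu
      obtain ⟨hvu, hul⟩ := hu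
      obtain ⟨i, hi, rfl⟩ := List.getElem_of_mem hul
      have h0 : i ≠ 0 := by
        rintro rfl
        exact hvu.ne (hl.getElem_zero hi).symm
      rw [Finset.mem_insert, Finset.mem_image]
      by_cases hil : i + 1 < l.length
      · right
        refine ⟨i, Finset.mem_Ico.2 ⟨by omega, ?_⟩, by simp [hi]⟩
        by_contra! h
        exact hshort i hi hil (by omega) hvu.symm
      · left
        have h1 := hl.last
        rw [List.getLast?_eq_getElem?, show l.length - 1 = i by omega,
          List.getElem?_eq_getElem hi] at h1
        exact Option.some.inj h1
    have h1 := Finset.card_le_card hsub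
    have h2 := Finset.card_insert_le x ((Finset.Ico 1 (m - 1)).image (fun i => l[i]?.getD v))
    have h3 := Finset.card_image_le (s := Finset.Ico 1 (m - 1)) (f := fun i => l[i]?.getD v)
    rw [Nat.card_Ico] at h3
    have h4 := Finset.card_filter_add_card_filter_not (s := Finset.univ.filter (G.Adj v)) (· ∈ l)
    omega

end Reduction

/-! ### Keyrings from cycles, and the conclusion. -/

theorem le_ncard_edgeSet_keyringGraph {c r : ℕ} (hc : 3 ≤ c) :
    c + r ≤ (keyringGraph c r).edgeSet.ncard := by
  obtain ⟨n, rfl⟩ : ∃ n, c = n + 3 := ⟨c - 3, by omega⟩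
  let f : Fin (n + 3) ⊕ Fin r → Sym2 (Fin (n + 3) ⊕ Fin r) := fun x =>
    match x with
    | Sum.inl i => s(Sum.inl i, Sum.inl (i + 1))
    | Sum.inr j => s(Sum.inl 0, Sum.inr j)
  have hf : Function.Injective f := by
    rintro (i | i) (j | j) h
    · simp only [f, Sym2.eq_iff, Sum.inl.injEq] at h
      rcases h with h | ⟨h1, h2⟩
      · rw [h.1]
      -- Two cycle edges can coincide reversed only if `2 = 0` modulo the cycle length, which length
      -- at least 3 excludes.
      · exfalso
        rw [h1, add_assoc] at h2
        have h3 : (1 : Fin (n + 3)) + 1 = 0 := by simpa using h2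
        rw [Fin.ext_iff, Fin.val_add] at h3
        have h4 : 2 % (n + 3) = 0 := by simpa using h3
        rw [Nat.mod_eq_of_lt (by omega)] at h4
        omega
    · simp [f] at h
    · simp [f] at h
    · simpa [f] using h
  have hsub : Set.range f ⊆ (keyringGraph (n + 3) r).edgeSet := by
    rintro _ ⟨i | j, rfl⟩
    · change (SimpleGraph.cycleGraph (n + 3)).Adj i (i + 1)
      rw [SimpleGraph.cycleGraph_adj]
      simp
    · change ((0 : Fin (n + 3)) : ℕ) = 0
      rfl
  have h1 := Set.ncard_le_ncard hsub (Set.toFinite _)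
  rw [Set.ncard_range_of_injective hf] at h1
  simpa using h1

open Classical in
/-- A cycle through `v` together with `r` neighbours of `v` off the cycle is a keyring. -/
theorem nonempty_keyringGraph_copy {V : Type*} [Fintype V] {G : SimpleGraph V} {v x : V}
    {l : List V} {r : ℕ} (hl : IsPathList G Set.univ v x l) (hxv : G.Adj x v)
    (hr : r ≤ ((Finset.univ.filter (G.Adj v)).filter (· ∉ l)).card) :
    Nonempty (SimpleGraph.Copy (keyringGraph l.length r) G) := by
  obtain ⟨R, hR, hRr⟩ := Finset.exists_subset_card_eq hr
  let e : Fin r ≃ R := (R.equivFinOfCardEq hRr).symm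
  have he : ∀ j, G.Adj v (e j) ∧ (e j : V) ∉ l := by
    intro j
    simpa using hR (e j).2
  -- Subtraction in `Fin` is cyclic, so the closing edge from `x` to `v` is the wrap-around case.
  have hstep : ∀ i j : Fin l.length, (i - j).val = 1 → G.Adj (l[j]) (l[i]) := by
    intro i j hij
    rw [Fin.val_sub] at hij
    have hi := i.2
    have hj := j.2
    by_cases hji : j.val ≤ i.val
    · have h1 : l.length - j.val + i.val = (i.val - j.val) + l.length := by omega
      rw [h1, Nat.add_mod_right, Nat.mod_eq_of_lt (by omega)] at hij
      have h2 := hl.chain.getElem j.val (by omega)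
      simpa only [Fin.getElem_fin, show i.val = j.val + 1 by omega] using h2
    · rw [Nat.mod_eq_of_lt (by omega)] at hij
      have hi0 : i.val = 0 := by omega
      have hjl : j.val = l.length - 1 := by omega
      have h1 := hl.last
      rw [List.getLast?_eq_getElem?, ← hjl, List.getElem?_eq_getElem hj] at h1
      have h2 := hl.getElem_zero (by omega)
      simp only [Fin.getElem_fin, hi0, h2, Option.some.inj h1]
      exact hxv
  let f : Fin l.length ⊕ Fin r → V := Sum.elim (fun i => l[i]) (fun j => e j)
  have hv : ∀ i : Fin l.length, i.val = 0 → l[i] = v := by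
    intro i hi
    have := hl.getElem_zero (by omega)
    simpa only [Fin.getElem_fin, hi] using this
  refine ⟨⟨⟨f, ?_⟩, ?_⟩⟩
  · rintro (i | i) (j | j) h
    · change (SimpleGraph.cycleGraph l.length).Adj i j at h
      rw [SimpleGraph.cycleGraph_adj'] at h
      rcases h with h | h
      · exact (hstep i j h).symm
      · exact hstep j i h
    · change i.val = 0 at h
      change G.Adj (l[i]) (e j)
      rw [hv i h]
      exact (he j).1
    · change j.val = 0 at h
      change G.Adj (e i) (l[j])
      rw [hv j h]
      exact (he i).1.symm
    · exact h.elim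
  · rintro (i | i) (j | j) h
    · change l[i] = l[j] at h
      rw [Fin.getElem_fin, Fin.getElem_fin, hl.nodup.getElem_inj_iff] at h
      rw [Fin.ext h]
    · change l[i] = e j at h
      exact absurd (h ▸ List.getElem_mem _) (he j).2
    · change (e i : V) = l[j] at h
      exact absurd (h ▸ List.getElem_mem _) (he i).2
    · change (e i : V) = e j at h
      rw [e.injective (Subtype.ext h)]

theorem theorem1p3 {V : Type*} [Fintype V] (G : SimpleGraph V) [DecidableRel G.Adj]
    (k r : ℕ) (hr : r + 3 ≤ k)
    (hG : ((k : ℝ) - 1) * (Fintype.card V : ℝ) / 2 < (G.edgeFinset.card : ℝ)) :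
    ∃ H : G.Subgraph, IsKeyring H.coe r ∧ k ≤ H.edgeSet.ncard := by
  classical
  have hne : Nonempty V := by
    by_contra h
    rw [not_nonempty_iff] at h
    have h0 : G.edgeFinset.card = 0 := by
      rw [Finset.card_eq_zero, Finset.eq_empty_iff_forall_notMem]
      intro e
      induction e with
      | _ a b => exact h.elim a
    simp [h0] at hG
  have hsum : (k - 1) * Fintype.card V < ∑ x, (Finset.univ.filter (G.Adj x)).card := by
    have h1 := G.sum_degrees_eq_twice_card_edges
    have h2 : ∀ x, (Finset.univ.filter (G.Adj x)).card = G.degree x := by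
      intro x
      rw [← SimpleGraph.card_neighborFinset_eq_degree]
      congr 1
      ext y
      simp
    simp only [h2, h1]
    have h3 : ((k - 1 : ℕ) : ℝ) = (k : ℝ) - 1 := by
      rw [Nat.cast_sub (by omega), Nat.cast_one]
    have h4 : (((k - 1) * Fintype.card V : ℕ) : ℝ) < ((2 * G.edgeFinset.card : ℕ) : ℝ) := by
      push_cast
      rw [h3]
      linarith
    exact_mod_cast h4
  obtain ⟨v, x, l, hl, hxv, hkl, hv⟩ := exists_cycle_list_through_heavy_vertex (G := G) k
    (by omega) (Nat.lt_of_le_of_lt (Nat.mul_le_mul_left _ (Nat.sub_le _ _)) (by convert hsum))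
  -- The cycle may shrink to length `k - r ≥ 3`, since the leaves make up for the `r` edges; the
  -- degree needed is `(k - r) - 1 + r = k - 1`.
  obtain ⟨x, l, hl, hxv, hml, hrl⟩ := exists_cycle_list_with_neighbors_off (k - r) r (by omega)
    hl hxv (by omega) (by omega)
  obtain ⟨f⟩ := nonempty_keyringGraph_copy hl hxv hrl
  refine ⟨f.toSubgraph, ⟨l.length, by omega, ⟨f.isoToSubgraph.symm⟩⟩, ?_⟩
  have h1 := le_ncard_edgeSet_keyringGraph (c := l.length) (r := r) (by omega)
  have h2 : f.toSubgraph.edgeSet.ncard = (keyringGraph l.length r).edgeSet.ncard := by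
    rw [SimpleGraph.Copy.toSubgraph, SimpleGraph.Subgraph.edgeSet_map,
      Set.ncard_image_of_injective _ (Sym2.map.injective f.injective)]
    simp
  omega
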